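/- Let $N\ge 3$, and let $\mathcal O_N$ be either the ring $\Bbbk[[T_1,\dots,T_N]]$ of formal power series in $N$ variables over an arbitrary field $\Bbbk$, or the ring of convergent power series in $N$ variables over a field $\Bbbk$ equipped with a multiplicative norm (the formal power series $\sum_\nu a_\nu T^\nu$ such that $\sum_\nu |a_\nu|\,r^{|\nu|}<\infty$ for some $r>0$). Let $\mathfrak m$ be the maximal ideal of $\mathcal O_N$. For a polynomial $f\in\mathcal O_N[X_1,\dots,X_n]$, its Artin function $\beta_f$ is defined as follows: for $i\in\mathbb N$, $\beta_f(i)$ is the smallest $b\in\mathbb N$ such that for every $x\in\mathcal O_N^n$ with $f(x)\in\mathfrak m^{b+1}$ there is $\overline x\in\mathcal O_N^n$ with $f(\overline x)=0$ and $x_j-\overline x_j\in\mathfrak m^{i+1}$ for all $j$ (with $\beta_f(i)=\infty$ if there is no such $b$). Then: (1) the Artin function $\beta$ of $X_1X_2-X_3X_4\in\mathcal O_N[X_1,X_2,X_3,X_4]$ satisfies $\beta(i)\ge i^2-1$ for every $i\in\mathbb N$; (2) consequently $\beta$ is not bounded above by any affine function: there are no $a,b\in\mathbb R$ with $\beta(i)\le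 ai+b$ for all $i\in\mathbb N$; (3) for every $i\in\mathbb N$, the Artin function of $XY-(T_1T_2-T_3^{\,i})\in\mathcal O_N[X,Y]$ is $l\mapsto\max(i,l)$; in particular it is constant equal to $i$ for $l\le i$. -/

import Mathlib

/-- `b` is an admissible value at `i` in the strong approximation property of the system of
polynomial equations `p = 0` (`p ∈ F`), for the pair `(A, I)`: every solution of the system
modulo `I ^ (b + 1)` agrees modulo `I ^ (i + 1)` with an exact solution in `A`. -/
def IsArtinBound {A σ : Type*} [CommRing A] (I : Ideal A) (F : Set (MvPolynomial σ A))
    (i b : ℕ) : Prop :=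
  ∀ x : σ → A, (∀ p ∈ F, MvPolynomial.eval x p ∈ I ^ (b + 1)) →
    ∃ y : σ → A, (∀ p ∈ F, MvPolynomial.eval y p = 0) ∧ ∀ j, x j - y j ∈ I ^ (i + 1)

/-- The Artin function of the system `F` for the pair `(A, I)`: its value at `i` is the smallest
admissible natural number, and `⊤` exactly when no natural number is admissible at `i`. -/
noncomputable def artinFunction {A σ : Type*} [CommRing A] (I : Ideal A)
    (F : Set (MvPolynomial σ A)) (i : ℕ) : ℕ∞ :=
  ⨅ (b : ℕ) (_ : IsArtinBound I F i b), (b : ℕ∞)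

/-- If there is a smallest function `β : ℕ → ℕ` with the strong approximation property, then it
is the Artin function defined above. -/
theorem artinFunction_eq_of_isLeast {A σ : Type*} [CommRing A] (I : Ideal A)
    (F : Set (MvPolynomial σ A)) (β : ℕ → ℕ)
    (h : IsLeast {β : ℕ → ℕ | ∀ i, IsArtinBound I F i (β i)} β) (i : ℕ) :
    artinFunction I F i = β i := by
  refine le_antisymm (iInf₂_le _ (h.1 i)) (le_iInf₂ fun b hb => ?_)
  have hmem : Function.update β i b ∈ {β : ℕ → ℕ | ∀ i, IsArtinBound I F i (β i)} := by
    intro j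
    by_cases hj : j = i
    · subst hj
      simpa using hb
    · simpa [Function.update_of_ne hj] using h.1 j
  have := h.2 hmem i
  simpa using this

/-- If some function `ℕ → ℕ` has the strong approximation property, then the Artin function is
finite and is the smallest such function. -/
theorem isLeast_artinFunction {A σ : Type*} [CommRing A] (I : Ideal A)
    (F : Set (MvPolynomial σ A)) (hex : ∃ β : ℕ → ℕ, ∀ i, IsArtinBound I F i (β i)) :
    ∃ β : ℕ → ℕ, IsLeast {β : ℕ → ℕ | ∀ i, IsArtinBound I F i (β i)} β ∧
      ∀ i, artinFunction I F i = β i := by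
  classical
  obtain ⟨γ, hγ⟩ := hex
  have hi : ∀ i, ∃ b, IsArtinBound I F i b := fun i => ⟨γ i, hγ i⟩
  have hl : IsLeast {β : ℕ → ℕ | ∀ i, IsArtinBound I F i (β i)} fun i => Nat.find (hi i) :=
    ⟨fun i => Nat.find_spec (hi i), fun δ hδ i => Nat.find_min' (hi i) (hδ i)⟩
  exact ⟨_, hl, artinFunction_eq_of_isLeast I F _ hl⟩

/-- The formal power series `f` in `N` variables converges absolutely on some polydisc of positive
radius around the origin. -/
def IsConvergentSeries {N : ℕ} {k : Type*} [NormedField k] (f : MvPowerSeries (Fin N) k) : Prop :=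
  ∃ r : ℝ, 0 < r ∧ Summable fun ν : Fin N →₀ ℕ => ‖MvPowerSeries.coeff ν f‖ * r ^ ν.degree

namespace IsConvergentSeries

variable {N : ℕ} {k : Type*} [NormedField k]

theorem summable_of_le {f : MvPowerSeries (Fin N) k} {r s : ℝ} (hs : 0 ≤ s) (hsr : s ≤ r)
    (h : Summable fun ν : Fin N →₀ ℕ => ‖MvPowerSeries.coeff ν f‖ * r ^ ν.degree) :
    Summable fun ν : Fin N →₀ ℕ => ‖MvPowerSeries.coeff ν f‖ * s ^ ν.degree :=
  h.of_nonneg_of_le (fun ν => by positivity) (fun ν => by gcongr)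

theorem of_finite {f : MvPowerSeries (Fin N) k} (s : Finset (Fin N →₀ ℕ))
    (h : ∀ ν ∉ s, MvPowerSeries.coeff ν f = 0) : IsConvergentSeries f :=
  ⟨1, one_pos, summable_of_ne_finset_zero (s := s) fun ν hν => by simp [h ν hν]⟩

theorem monomial (ν : Fin N →₀ ℕ) (a : k) : IsConvergentSeries (MvPowerSeries.monomial ν a) := by
  classical
  refine of_finite {ν} fun μ hμ => ?_
  rw [MvPowerSeries.coeff_monomial, if_neg (by simpa using hμ)]

theorem add {f g : MvPowerSeries (Fin N) k} (hf : IsConvergentSeries f)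
    (hg : IsConvergentSeries g) : IsConvergentSeries (f + g) := by
  obtain ⟨r, hr, hf⟩ := hf
  obtain ⟨s, hs, hg⟩ := hg
  have hm : 0 < min r s := lt_min hr hs
  refine ⟨min r s, hm, ((summable_of_le hm.le (min_le_left _ _) hf).add
    (summable_of_le hm.le (min_le_right _ _) hg)).of_nonneg_of_le
      (fun ν => by positivity) (fun ν => ?_)⟩
  rw [map_add, ← add_mul]
  gcongr
  exact norm_add_le _ _

theorem neg {f : MvPowerSeries (Fin N) k} (hf : IsConvergentSeries f) :
    IsConvergentSeries (-f) := by
  obtain ⟨r, hr, hf⟩ := hf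
  exact ⟨r, hr, by simpa using hf⟩

theorem mul {f g : MvPowerSeries (Fin N) k} (hf : IsConvergentSeries f)
    (hg : IsConvergentSeries g) : IsConvergentSeries (f * g) := by
  classical
  obtain ⟨r, hr, hf⟩ := hf
  obtain ⟨s, hs, hg⟩ := hg
  have hm : 0 < min r s := lt_min hr hs
  have hf' := summable_of_le hm.le (min_le_left r s) hf
  have hg' := summable_of_le hm.le (min_le_right r s) hg
  set ρ : ℝ := min r s
  let u : (Fin N →₀ ℕ) → ℝ := fun ν => ‖MvPowerSeries.coeff ν f‖ * ρ ^ ν.degree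
  let v : (Fin N →₀ ℕ) → ℝ := fun ν => ‖MvPowerSeries.coeff ν g‖ * ρ ^ ν.degree
  have hu : ∀ ν, 0 ≤ u ν := fun ν => mul_nonneg (norm_nonneg _) (pow_nonneg hm.le _)
  have hv : ∀ ν, 0 ≤ v ν := fun ν => mul_nonneg (norm_nonneg _) (pow_nonneg hm.le _)
  have hprod : Summable fun p : (Fin N →₀ ℕ) × (Fin N →₀ ℕ) => u p.1 * v p.2 :=
    Summable.mul_of_nonneg (f := u) (g := v) hf' hg' hu hv
  have hsum := summable_sum_mul_antidiagonal_of_summable_mul hprod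
  have hle : ∀ ν, ‖MvPowerSeries.coeff ν (f * g)‖ * ρ ^ ν.degree ≤
      ∑ p ∈ Finset.HasAntidiagonal.antidiagonal ν, u p.1 * v p.2 := by
    intro ν
    rw [MvPowerSeries.coeff_mul]
    refine (mul_le_mul_of_nonneg_right (norm_sum_le _ _) (pow_nonneg hm.le _)).trans
      (le_of_eq ?_)
    rw [Finset.sum_mul]
    refine Finset.sum_congr rfl fun p hp => ?_
    rw [← Finset.HasAntidiagonal.mem_antidiagonal.1 hp, map_add, pow_add, norm_mul]
    simp only [u, v]
    ring
  exact ⟨ρ, hm, Summable.of_nonneg_of_le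
    (fun ν => mul_nonneg (norm_nonneg _) (pow_nonneg hm.le _)) hle hsum⟩

end IsConvergentSeries

/-- The ring of convergent power series in `N` variables over the normed field `k`. -/
def convergentSeries (N : ℕ) (k : Type*) [NormedField k] : Subring (MvPowerSeries (Fin N) k) where
  carrier := {f | IsConvergentSeries f}
  mul_mem' := IsConvergentSeries.mul
  one_mem' := IsConvergentSeries.monomial 0 1
  add_mem' := IsConvergentSeries.add
  zero_mem' := IsConvergentSeries.of_finite ∅ (by simp)
  neg_mem' := IsConvergentSeries.neg

/-- The variable `T_j` as a convergent power series. -/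
noncomputable def convergentSeries.T {N : ℕ} (k : Type*) [NormedField k] (j : Fin N) :
    convergentSeries N k :=
  ⟨MvPowerSeries.X j, show IsConvergentSeries (MvPowerSeries.X j) from
    IsConvergentSeries.monomial (Finsupp.single j 1) 1⟩

/-- A convergent power series that is invertible as a formal power series has a convergent
inverse. -/
theorem IsConvergentSeries.of_mul_eq_one {N : ℕ} {k : Type*} [NormedField k]
    {f g : MvPowerSeries (Fin N) k} (hf : IsConvergentSeries f) (hfg : f * g = 1) :
    IsConvergentSeries g := by
  classical
  obtain ⟨r, hr, hs⟩ := hf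
  set a : (Fin N →₀ ℕ) → ℝ := fun ν => ‖MvPowerSeries.coeff ν f‖ with ha
  set b : (Fin N →₀ ℕ) → ℝ := fun ν => ‖MvPowerSeries.coeff ν g‖ with hb
  have ha0 : 0 < a 0 := by
    have h := congrArg (MvPowerSeries.coeff (0 : Fin N →₀ ℕ)) hfg
    simp only [MvPowerSeries.coeff_zero_eq_constantCoeff, map_mul, map_one] at h
    simp only [ha, norm_pos_iff, MvPowerSeries.coeff_zero_eq_constantCoeff]
    exact left_ne_zero_of_mul_eq_one h
  set S : ℝ := ∑' ν, a ν * r ^ ν.degree with hS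
  have hS0 : 0 ≤ S := tsum_nonneg fun ν => by positivity
  -- Shrink the radius so that the terms of positive degree have total weight at most `a 0 / 2`.
  set t : ℝ := min 1 (a 0 / (2 * (S + 1))) with ht
  have ht0 : 0 < t := by positivity
  have ht1 : t ≤ 1 := min_le_left _ _
  have htS : t * S ≤ a 0 / 2 := by
    have h1 : t * (2 * (S + 1)) ≤ a 0 := (le_div_iff₀ (by positivity)).1 (min_le_right _ _)
    nlinarith
  set ρ : ℝ := t * r with hρ
  have hρ0 : 0 < ρ := by positivity
  have hsmall : ∀ s : Finset (Fin N →₀ ℕ),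
      ∑ μ ∈ s with μ ≠ 0, a μ * ρ ^ μ.degree ≤ a 0 / 2 := by
    intro s
    calc ∑ μ ∈ s with μ ≠ 0, a μ * ρ ^ μ.degree
        ≤ ∑ μ ∈ s with μ ≠ 0, t * (a μ * r ^ μ.degree) := by
          refine Finset.sum_le_sum fun μ hμ => ?_
          have hd : μ.degree ≠ 0 := by
            rw [Ne, Finsupp.degree_eq_zero_iff]
            exact (Finset.mem_filter.1 hμ).2
          rw [hρ, mul_pow]
          have : t ^ μ.degree ≤ t := pow_le_of_le_one ht0.le ht1 hd
          calc a μ * (t ^ μ.degree * r ^ μ.degree) ≤ a μ * (t * r ^ μ.degree) := by gcongr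
            _ = _ := by ring
      _ = t * ∑ μ ∈ s with μ ≠ 0, a μ * r ^ μ.degree := by rw [Finset.mul_sum]
      _ ≤ t * S := by
          gcongr
          exact hs.sum_le_tsum _ fun ν _ => by positivity
      _ ≤ _ := htS
  have hrec : ∀ ν : Fin N →₀ ℕ, a 0 * (b ν * ρ ^ ν.degree) ≤ (if ν = 0 then 1 else 0) +
      ∑ p ∈ Finset.HasAntidiagonal.antidiagonal ν with p.1 ≠ 0,
        (a p.1 * ρ ^ p.1.degree) * (b p.2 * ρ ^ p.2.degree) := by
    intro ν
    have h := congrArg (MvPowerSeries.coeff ν) hfg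
    rw [MvPowerSeries.coeff_mul, MvPowerSeries.coeff_one,
      ← Finset.sum_filter_add_sum_filter_not _ (fun p => p.1 ≠ 0)] at h
    have hsing : (Finset.HasAntidiagonal.antidiagonal ν).filter (fun p => ¬ p.1 ≠ 0) = {(0, ν)} := by
      ext ⟨p, q⟩
      simp only [not_not, Finset.mem_filter, Finset.HasAntidiagonal.mem_antidiagonal, Finset.mem_singleton,
        Prod.mk.injEq]
      constructor
      · rintro ⟨h1, rfl⟩
        exact ⟨rfl, by simpa using h1⟩
      · rintro ⟨rfl, rfl⟩
        simp
    rw [hsing, Finset.sum_singleton] at h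
    have h2 := eq_sub_of_add_eq' h
    have h3 : a 0 * b ν ≤ (if ν = 0 then 1 else 0) +
        ∑ p ∈ Finset.HasAntidiagonal.antidiagonal ν with p.1 ≠ 0, a p.1 * b p.2 := by
      calc a 0 * b ν = ‖MvPowerSeries.coeff 0 f * MvPowerSeries.coeff ν g‖ := by rw [norm_mul]
        _ ≤ ‖(if ν = 0 then (1 : k) else 0)‖ + ‖∑ p ∈ Finset.HasAntidiagonal.antidiagonal ν with p.1 ≠ 0,
              MvPowerSeries.coeff p.1 f * MvPowerSeries.coeff p.2 g‖ := by
            rw [h2]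
            exact norm_sub_le _ _
        _ ≤ _ := by
            refine add_le_add (by split_ifs <;> simp) ((norm_sum_le _ _).trans (le_of_eq ?_))
            exact Finset.sum_congr rfl fun p _ => norm_mul _ _
    calc a 0 * (b ν * ρ ^ ν.degree) = (a 0 * b ν) * ρ ^ ν.degree := by ring
      _ ≤ ((if ν = 0 then 1 else 0) +
        ∑ p ∈ Finset.HasAntidiagonal.antidiagonal ν with p.1 ≠ 0, a p.1 * b p.2) * ρ ^ ν.degree := by gcongr
      _ = _ := by
        rw [add_mul, Finset.sum_mul]
        congr 1
        · split_ifs with h0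
          · simp [h0]
          · simp
        · refine Finset.sum_congr rfl fun p hp => ?_
          rw [← Finset.HasAntidiagonal.mem_antidiagonal.1 (Finset.mem_filter.1 hp).1, map_add, pow_add]
          ring
  have hbox : ∀ d : Fin N →₀ ℕ, ∑ ν ∈ Finset.Iic d, b ν * ρ ^ ν.degree ≤ 2 / a 0 := by
    intro d
    set B : ℝ := ∑ ν ∈ Finset.Iic d, b ν * ρ ^ ν.degree with hB
    have hB0 : 0 ≤ B := Finset.sum_nonneg fun ν _ => by positivity
    have h1 : a 0 * B ≤ 1 + ∑ ν ∈ Finset.Iic d, ∑ p ∈ Finset.HasAntidiagonal.antidiagonal ν with p.1 ≠ 0,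
        (a p.1 * ρ ^ p.1.degree) * (b p.2 * ρ ^ p.2.degree) := by
      rw [hB, Finset.mul_sum]
      refine (Finset.sum_le_sum fun ν _ => hrec ν).trans ?_
      rw [Finset.sum_add_distrib]
      gcongr
      rw [Finset.sum_ite_eq']
      split_ifs <;> simp
    have h2 : ∑ ν ∈ Finset.Iic d, ∑ p ∈ Finset.HasAntidiagonal.antidiagonal ν with p.1 ≠ 0,
        (a p.1 * ρ ^ p.1.degree) * (b p.2 * ρ ^ p.2.degree) ≤
        (∑ μ ∈ Finset.Iic d with μ ≠ 0, a μ * ρ ^ μ.degree) * B := by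
      rw [hB, Finset.sum_mul_sum, ← Finset.sum_product', Finset.sum_sigma',
        ← Finset.sum_image (s := (Finset.Iic d).sigma fun ν =>
            (Finset.HasAntidiagonal.antidiagonal ν).filter fun p => p.1 ≠ 0) (g := fun x => x.2)
          (f := fun p : (Fin N →₀ ℕ) × (Fin N →₀ ℕ) =>
            (a p.1 * ρ ^ p.1.degree) * (b p.2 * ρ ^ p.2.degree))]
      · refine Finset.sum_le_sum_of_subset_of_nonneg ?_ fun p _ _ => by positivity
        intro p hp
        obtain ⟨⟨ν, q⟩, hx, rfl⟩ := Finset.mem_image.1 hp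
        simp only [Finset.mem_sigma, Finset.mem_Iic, Finset.mem_filter,
          Finset.HasAntidiagonal.mem_antidiagonal] at hx
        obtain ⟨hν, rfl, hq⟩ := hx
        simp only [Finset.mem_product, Finset.mem_filter, Finset.mem_Iic]
        exact ⟨⟨le_self_add.trans hν, hq⟩, le_add_self.trans hν⟩
      · rintro ⟨ν, q⟩ hx ⟨ν', q'⟩ hx' h
        simp only [Finset.coe_sigma, Set.mem_sigma_iff, Finset.mem_coe, Finset.mem_filter,
          Finset.HasAntidiagonal.mem_antidiagonal] at hx hx'
        obtain rfl : q = q' := h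
        obtain rfl : ν = ν' := hx.2.1.symm.trans hx'.2.1
        rfl
    have h3 : (∑ μ ∈ Finset.Iic d with μ ≠ 0, a μ * ρ ^ μ.degree) * B ≤ a 0 / 2 * B := by
      gcongr
      exact hsmall _
    rw [le_div_iff₀ ha0]
    linarith
  refine ⟨ρ, hρ0, summable_of_sum_le (c := 2 / a 0) (fun ν => by positivity) fun u => ?_⟩
  refine le_trans (Finset.sum_le_sum_of_subset_of_nonneg (t := Finset.Iic (u.sup id)) ?_
    fun ν _ _ => by positivity) (hbox (u.sup id))
  intro ν hν
  exact Finset.mem_Iic.2 (Finset.le_sup (f := id) hν)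

instance convergentSeries.isLocalRing (N : ℕ) (k : Type*) [NormedField k] :
    IsLocalRing (convergentSeries N k) := by
  have : IsLocalHom (convergentSeries N k).subtype := by
    refine ⟨fun f hf => ?_⟩
    obtain ⟨g, hg⟩ := hf.exists_right_inv
    exact IsUnit.of_mul_eq_one ⟨g, f.2.of_mul_eq_one hg⟩ (Subtype.ext hg)
  exact RingHom.domain_isLocalRing (convergentSeries N k).subtype

/-- The polynomial `X₁ X₂ - X₃ X₄` in four variables over `A`. -/
noncomputable def crossPolynomial (A : Type*) [CommRing A] : MvPolynomial (Fin 4) A :=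
  MvPolynomial.X 0 * MvPolynomial.X 1 - MvPolynomial.X 2 * MvPolynomial.X 3

/-- The polynomial `X Y - c` in two variables over `A`, for a constant `c ∈ A`. -/
noncomputable def productPolynomial {A : Type*} [CommRing A] (c : A) : MvPolynomial (Fin 2) A :=
  MvPolynomial.X 0 * MvPolynomial.X 1 - MvPolynomial.C c

/-!
The core of the argument is that a power series `p = X a * X b - X c ^ i + h` with `2 ≤ i` and `h` of
order at least `i + 1` is prime (`MvPowerSeries.prime_X_mul_X_sub_X_pow_add`). Give `X a` and `X b`
weight `3` and the other variables weight `4`: the initial term of `p` is then `X a * X b`, so division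
by `p` (`MvPowerSeries.exists_eq_mul_add`) replaces any series by a remainder without monomials
divisible by `X a * X b`. Suppose that the product of two nonzero remainders `r`, `s` is `p * z`, and
substitute `X a ↦ X a ^ i`, `X b ↦ X b ^ i`, `X c ↦ X a * X b`. With `X a`, `X b` of weight `i` in the
source and `1` in the target, and all other variables of weight `2`, weights are preserved, and no
cancellation occurs in `r` and `s`, so their weighted orders do not increase. But `p` has weighted
order at most `2 * i` and is mapped to the image of `h`, of weighted order at least `2 * i + 2`. As
weighted orders are additive, this is a contradiction.

Both rings are treated at once as a local ring `A` with a local homomorphism to the ring of formal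
power series. For `X₁ X₂ - X₃ X₄` the approximate solution `(T₁ ^ i, T₂ ^ i, T₁ T₂ - T₃ ^ i, s)` with
`s = ((T₁ T₂) ^ i - T₃ ^ (i ^ 2)) / (T₁ T₂ - T₃ ^ i)` has error `T₃ ^ (i ^ 2)`, and an exact solution
that agrees with it modulo `𝔪 ^ (i + 1)` has a prime third coordinate, which has to divide one of the
first two; the coefficient of `T₁ ^ i`, respectively `T₂ ^ i`, excludes this
(`le_artinFunction_crossPolynomial`). For `X Y - (T₁ T₂ - T₃ ^ i)`, a solution modulo `𝔪 ^ (i + 1)` has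
a unit coordinate, so that the other coordinate can be corrected without loss of precision, while
for `1 ≤ i` the vector `(T₁, T₂)` is a solution modulo `𝔪 ^ i` not congruent to any exact one modulo
`𝔪`, and `(1, T₁ T₂ - T₃ ^ i + T₃ ^ l)` shows that precision `l` cannot be avoided
(`artinFunction_productPolynomial`).
-/

namespace MvPowerSeries

/-! ### Division of power series -/

/-- A map that strictly increases the weighted order of differences has a fixed point: the
iterates starting from `0` stabilise coefficient by coefficient. Weights may vanish, and `σ` may be
infinite. -/
theorem exists_fixedPoint_of_contracting {σ R : Type*} [CommRing R] (w : σ → ℕ)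
    (Φ : MvPowerSeries σ R → MvPowerSeries σ R)
    (hΦ : ∀ (n : ℕ) (f g : MvPowerSeries σ R), (n : ℕ∞) ≤ (f - g).weightedOrder w →
      ((n + 1 : ℕ) : ℕ∞) ≤ (Φ f - Φ g).weightedOrder w) :
    ∃ f, Φ f = f := by
  set z : ℕ → MvPowerSeries σ R := fun n => Φ^[n] 0 with hz
  have hsucc (n : ℕ) : z (n + 1) = Φ (z n) := Function.iterate_succ_apply' Φ n 0
  have hstep (n : ℕ) : (n : ℕ∞) ≤ (z (n + 1) - z n).weightedOrder w := by
    induction n with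
    | zero => simp
    | succ n ih => rw [hsucc (n + 1), hsucc n]; exact hΦ n _ _ (by rwa [hsucc n] at ih)
  have hstab (ν : σ →₀ ℕ) (n : ℕ) (hn : Finsupp.weight w ν + 1 ≤ n) :
      coeff ν (z n) = coeff ν (z (Finsupp.weight w ν + 1)) := by
    induction n, hn using Nat.le_induction with
    | base => rfl
    | succ n hn ih =>
      rw [← ih, ← sub_eq_zero, ← map_sub]
      exact coeff_eq_zero_of_lt_weightedOrder w (lt_of_lt_of_le (by exact_mod_cast hn) (hstep n))
  let y : MvPowerSeries σ R := fun ν => coeff ν (z (Finsupp.weight w ν + 1))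
  have hy (ν : σ →₀ ℕ) : coeff ν y = coeff ν (z (Finsupp.weight w ν + 1)) := rfl
  have hlim (n : ℕ) : (n : ℕ∞) ≤ (y - z n).weightedOrder w := by
    refine nat_le_weightedOrder w fun ν hν => ?_
    rw [map_sub, hy, hstab ν n hν, sub_self]
  refine ⟨y, ?_⟩
  ext ν
  set n := Finsupp.weight w ν with hn
  have hlt : (n : ℕ∞) < ((n + 1 : ℕ) : ℕ∞) := by exact_mod_cast n.lt_succ_self
  have h1 := coeff_eq_zero_of_lt_weightedOrder w (hlt.trans_le (hΦ n _ _ (hlim n)))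
  have h2 := coeff_eq_zero_of_lt_weightedOrder w (hlt.trans_le (hlim (n + 1)))
  rw [hsucc, map_sub, sub_eq_zero] at h2
  rw [map_sub, sub_eq_zero] at h1
  rw [h1, h2]

/-- Division with remainder by a power series with initial term `X ^ τ`: the remainder has no
monomial divisible by `X ^ τ`. With `Q g` the quotient of the part of `g` divisible by `X ^ τ`, the
quotient of `f` by `X ^ τ - e` is the fixed point of `q ↦ Q (f + e * q)`. -/
theorem exists_eq_mul_add {σ R : Type*} [CommRing R] (w : σ → ℕ) (τ : σ →₀ ℕ)
    (e : MvPowerSeries σ R)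
    (he : ((Finsupp.weight w τ + 1 : ℕ) : ℕ∞) ≤ e.weightedOrder w) (f : MvPowerSeries σ R) :
    ∃ q r : MvPowerSeries σ R, f = (monomial τ 1 - e) * q + r ∧ ∀ ν, τ ≤ ν → coeff ν r = 0 := by
  let Q : MvPowerSeries σ R → MvPowerSeries σ R := fun g ν => coeff (τ + ν) g
  have hQ (g : MvPowerSeries σ R) (ν : σ →₀ ℕ) : coeff ν (Q g) = coeff (τ + ν) g := rfl
  obtain ⟨q, hq⟩ := exists_fixedPoint_of_contracting w (fun q => Q (f + e * q)) (by
    intro n g₁ g₂ hg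
    refine nat_le_weightedOrder w fun ν hν => ?_
    rw [map_sub, hQ, hQ, ← map_sub, add_sub_add_left_eq_sub, ← mul_sub]
    refine coeff_eq_zero_of_lt_weightedOrder w
      (lt_of_lt_of_le ?_ ((add_le_add he hg).trans (le_weightedOrder_mul w)))
    rw [map_add]
    norm_cast
    omega)
  refine ⟨q, f + e * q - monomial τ 1 * q, by ring, fun ν hν => ?_⟩
  obtain ⟨μ, rfl⟩ := exists_add_of_le hν
  rw [map_sub, coeff_add_monomial_mul, one_mul, sub_eq_zero, ← hQ, hq]

/-! ### Monomial substitutions -/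

theorem prod_monomial_pow {σ τ R : Type*} [CommSemiring R] (e : σ → τ →₀ ℕ) (d : σ →₀ ℕ) :
    (d.prod fun s n => (monomial (e s) (1 : R)) ^ n) =
      monomial (Finsupp.linearCombination ℕ e d) 1 := by
  simp [Finsupp.prod, monomial_pow, prod_monomial, Finsupp.linearCombination_apply, Finsupp.sum]

/-- A monomial substitution does not raise the weighted order of `f` if distinct monomials of `f`
have distinct images, since then no cancellation can occur. -/
theorem weightedOrder_subst_monomial_le {σ τ R : Type*} [CommRing R] [Nontrivial R]
    (w : σ → ℕ) (w' : τ → ℕ) (e : σ → τ →₀ ℕ)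
    (hsub : HasSubst fun s => (monomial (e s) (1 : R)))
    (hw : ∀ s, Finsupp.weight w' (e s) = w s) (f : MvPowerSeries σ R)
    (hinj : ∀ μ ν, coeff μ f ≠ 0 → coeff ν f ≠ 0 →
      Finsupp.linearCombination ℕ e μ = Finsupp.linearCombination ℕ e ν → μ = ν) :
    (f.subst fun s => (monomial (e s) (1 : R))).weightedOrder w' ≤ f.weightedOrder w := by
  classical
  rcases eq_or_ne f 0 with rfl | hf
  · simp
  obtain ⟨ν, hν, hνw⟩ := exists_coeff_ne_zero_and_weightedOrder w
    ((ne_zero_iff_weightedOrder_finite w).1 hf)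
  have hweight : Finsupp.weight w' (Finsupp.linearCombination ℕ e ν) = Finsupp.weight w ν := by
    simp [Finsupp.linearCombination_apply, Finsupp.weight_apply w, map_finsuppSum, hw]
  rw [← hνw, ← hweight]
  refine weightedOrder_le w' ?_
  rw [coeff_subst hsub, finsum_eq_single _ ν]
  · simpa [prod_monomial_pow] using hν
  · intro μ hμ
    rw [prod_monomial_pow, coeff_monomial]
    split_ifs with h
    · by_contra h0
      exact hμ (hinj μ ν (fun h' => h0 (by simp [h'])) hν h.symm)
    · simp

/-- The exponents of the monomials in the substitution `X a ↦ X a ^ i`, `X b ↦ X b ^ i`,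
`X c ↦ X a * X b`, all other variables being fixed. It parametrizes the hypersurface
`X a * X b = X c ^ i` by its cyclic cover. -/
noncomputable def coverExponent {σ : Type*} [DecidableEq σ] (a b c : σ) (i : ℕ) (s : σ) : σ →₀ ℕ :=
  if s = a then Finsupp.single a i
  else if s = b then Finsupp.single b i
  else if s = c then Finsupp.single a 1 + Finsupp.single b 1
  else Finsupp.single s 1

theorem linearCombination_coverExponent_left {σ : Type*} [DecidableEq σ] {a b c : σ} (hab : a ≠ b)
    (hac : a ≠ c) (hbc : b ≠ c) (i : ℕ) (d : σ →₀ ℕ) :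
    Finsupp.linearCombination ℕ (coverExponent a b c i) d a = i * d a + d c := by
  induction d using Finsupp.induction_linear with
  | zero => simp
  | add d₁ d₂ h₁ h₂ => simp only [map_add, Finsupp.add_apply, h₁, h₂]; ring
  | single s n =>
    simp only [Finsupp.linearCombination_single, coverExponent]
    split_ifs <;> simp_all [Finsupp.single_apply, mul_comm, eq_comm]

theorem linearCombination_coverExponent_right {σ : Type*} [DecidableEq σ] {a b c : σ} (hab : a ≠ b)
    (hac : a ≠ c) (hbc : b ≠ c) (i : ℕ) (d : σ →₀ ℕ) :
    Finsupp.linearCombination ℕ (coverExponent a b c i) d b = i * d b + d c := by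
  induction d using Finsupp.induction_linear with
  | zero => simp
  | add d₁ d₂ h₁ h₂ => simp only [map_add, Finsupp.add_apply, h₁, h₂]; ring
  | single s n =>
    simp only [Finsupp.linearCombination_single, coverExponent]
    split_ifs <;> simp_all [Finsupp.single_apply, mul_comm, eq_comm]

theorem linearCombination_coverExponent_of_ne {σ : Type*} [DecidableEq σ] {a b c j : σ} (ha : j ≠ a)
    (hb : j ≠ b) (hc : j ≠ c) (i : ℕ) (d : σ →₀ ℕ) : Finsupp.linearCombination ℕ (coverExponent a b c i) d j = d j := by
  induction d using Finsupp.induction_linear with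
  | zero => simp
  | add d₁ d₂ h₁ h₂ => simp only [map_add, Finsupp.add_apply, h₁, h₂]
  | single s n =>
    simp only [Finsupp.linearCombination_single, coverExponent]
    split_ifs <;> simp_all [Finsupp.single_apply, mul_comm, eq_comm]

/-- The cyclic cover separates the monomials that are not divisible by `X a * X b`: the difference
of the exponents of `X a` and `X b` in the image is `i` times the original one. -/
theorem linearCombination_coverExponent_injective {σ : Type*} [DecidableEq σ] {a b c : σ}
    (hab : a ≠ b) (hac : a ≠ c) (hbc : b ≠ c) {i : ℕ} (hi : 0 < i) {μ ν : σ →₀ ℕ}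
    (hμ : μ a = 0 ∨ μ b = 0) (hν : ν a = 0 ∨ ν b = 0)
    (h : Finsupp.linearCombination ℕ (coverExponent a b c i) μ =
      Finsupp.linearCombination ℕ (coverExponent a b c i) ν) : μ = ν := by
  have ha := DFunLike.congr_fun h a
  have hb := DFunLike.congr_fun h b
  rw [linearCombination_coverExponent_left hab hac hbc,
    linearCombination_coverExponent_left hab hac hbc] at ha
  rw [linearCombination_coverExponent_right hab hac hbc,
    linearCombination_coverExponent_right hab hac hbc] at hb
  have key : μ a = ν a ∧ μ b = ν b := by
    have e : (i : ℤ) * (μ a - μ b - (ν a - ν b)) = 0 := by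
      zify at ha hb
      linear_combination ha - hb
    have e' := (mul_eq_zero.1 e).resolve_left (by exact_mod_cast hi.ne')
    omega
  ext j
  by_cases h1 : j = a
  · rw [h1, key.1]
  by_cases h2 : j = b
  · rw [h2, key.2]
  by_cases h3 : j = c
  · rw [h3]; rw [key.1] at ha; omega
  · have hj := DFunLike.congr_fun h j
    rwa [linearCombination_coverExponent_of_ne h1 h2 h3,
      linearCombination_coverExponent_of_ne h1 h2 h3] at hj

/-! ### Primality of deformations of `X a * X b - X c ^ i` -/

theorem nsmul_order_le_weightedOrder {σ R : Type*} [Semiring R] (w : σ → ℕ) (m : ℕ)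
    (hm : ∀ s, m ≤ w s) (f : MvPowerSeries σ R) :
    m • f.order ≤ f.weightedOrder w := by
  refine le_weightedOrder w fun d hd => coeff_of_lt_order ?_
  have h : m * d.degree ≤ Finsupp.weight w d := by
    rw [Finsupp.weight_apply, Finsupp.degree_apply, Finset.mul_sum, Finsupp.sum]
    exact Finset.sum_le_sum fun s _ => by rw [smul_eq_mul, mul_comm]; gcongr; exact hm s
  by_contra! hle
  have h2 : ((m * d.degree : ℕ) : ℕ∞) < m • f.order := lt_of_le_of_lt (by exact_mod_cast h) hd
  rw [nsmul_eq_mul, Nat.cast_mul] at h2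
  exact absurd h2 (not_lt.2 (by gcongr))

/-- Every power series that agrees with `X a * X b - X c ^ i` up to terms of order greater than `i`
is prime. Divisibility of a product is tested on remainders without monomials divisible by
`X a * X b`; on these the cyclic cover preserves the weighted order, whereas it maps `p` to a
series of larger order than `p`. -/
theorem prime_X_mul_X_sub_X_pow_add {σ R : Type*} [Finite σ] [CommRing R] [IsDomain R] {a b c : σ}
    (hab : a ≠ b) (hac : a ≠ c) (hbc : b ≠ c) {i : ℕ} (hi : 2 ≤ i) {h : MvPowerSeries σ R}
    (hh : ((i + 1 : ℕ) : ℕ∞) ≤ h.order) :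
    Prime (X a * X b - X c ^ i + h) := by
  classical
  set p : MvPowerSeries σ R := X a * X b - X c ^ i + h with hp
  set τ : σ →₀ ℕ := Finsupp.single a 1 + Finsupp.single b 1 with hτ
  have hXX : (X a * X b : MvPowerSeries σ R) = monomial τ 1 := by
    rw [X, X, monomial_mul_monomial, one_mul]
  have hle (ν : σ →₀ ℕ) : τ ≤ ν ↔ 1 ≤ ν a ∧ 1 ≤ ν b := by
    constructor
    · intro h
      have ha := h a
      have hb := h b
      simp [hτ, hab, hab.symm] at ha hb
      exact ⟨ha, hb⟩
    · rintro ⟨ha, hb⟩ s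
      simp only [hτ, Finsupp.add_apply, Finsupp.single_apply]
      split_ifs <;> simp_all
  have hcoeff : coeff τ p = 1 := by
    have h1 : τ ≠ Finsupp.single c i := fun h => by
      have := DFunLike.congr_fun h a
      simp [hτ, hac.symm, hab.symm] at this
    have h2 : coeff τ h = 0 := coeff_of_lt_order (lt_of_lt_of_le
      (by simp only [hτ, map_add, Finsupp.degree_single]; exact_mod_cast (by omega)) hh)
    rw [hp, map_add, map_sub, hXX, coeff_monomial_same, coeff_X_pow, if_neg h1, h2]
    simp
  have hp0 : p ≠ 0 := fun h => by simp [h] at hcoeff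
  refine ⟨hp0, ?_, ?_⟩
  · rw [isUnit_iff_constantCoeff]
    have h0 : constantCoeff h = 0 := one_le_order_iff_constCoeff_eq_zero.1
      (le_trans (by exact_mod_cast (by omega)) hh)
    simp [hp, h0, zero_pow (by omega : i ≠ 0)]
  -- Weights for which `X a * X b` is the initial term of `p`.
  have hdiv (f : MvPowerSeries σ R) :
      ∃ q r : MvPowerSeries σ R, f = p * q + r ∧ ∀ ν, coeff ν r ≠ 0 → ν a = 0 ∨ ν b = 0 := by
    set v : σ → ℕ := fun s => if s = a ∨ s = b then 3 else 4 with hv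
    obtain ⟨q, r, hf, hr⟩ := exists_eq_mul_add v τ (X c ^ i - h) (by
      have h1 : Finsupp.weight v τ = 6 := by simp [hτ, hv, Finsupp.weight_single]
      rw [h1, sub_eq_add_neg]
      refine le_trans (le_min ?_ ?_) (min_weightedOrder_le_add v)
      · rw [X_pow_eq, weightedOrder_monomial_of_ne_zero v one_ne_zero, Finsupp.weight_single]
        simp only [hv, hac.symm, hbc.symm]
        exact_mod_cast (by simp; omega)
      · rw [weightedOrder_neg]
        refine le_trans ?_ (nsmul_order_le_weightedOrder v 3 (fun s => by
          simp only [hv]; split_ifs <;> omega) h)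
        refine le_trans ?_ (nsmul_le_nsmul_right hh 3)
        rw [nsmul_eq_mul]
        exact_mod_cast (by omega)) f
    refine ⟨q, r, ?_, fun ν hν => ?_⟩
    · rw [hf, hp, hXX]; ring
    · by_contra! h0
      exact hν (hr ν ((hle ν).2 ⟨by omega, by omega⟩))
  -- For these weights `X a * X b - X c ^ i` is the initial form of `p`, and the substitution is
  -- compatible with the weights `w` on its source and `w'` on its target.
  set w : σ → ℕ := fun s => if s = a ∨ s = b then i else 2 with hw
  set w' : σ → ℕ := fun s => if s = a ∨ s = b then 1 else 2 with hw'
  have hsub : HasSubst fun s => (monomial (coverExponent a b c i s) (1 : R)) := by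
    refine hasSubst_of_constantCoeff_zero fun s => ?_
    rw [← coeff_zero_eq_constantCoeff_apply, coeff_monomial, if_neg]
    intro h
    have := congrArg (Finsupp.degree) h
    simp only [coverExponent] at this
    split_ifs at this <;> simp at this <;> omega
  have hww (s : σ) : Finsupp.weight w' (coverExponent a b c i s) = w s := by
    simp only [coverExponent, hw, hw']
    split_ifs <;> simp_all [Finsupp.weight_single]
  have hψ_le {f : MvPowerSeries σ R} (hf : ∀ ν, coeff ν f ≠ 0 → ν a = 0 ∨ ν b = 0) :=
    weightedOrder_subst_monomial_le w w' _ hsub hww f fun μ ν hμ hν h =>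
      linearCombination_coverExponent_injective hab hac hbc (by omega) (hf μ hμ) (hf ν hν) h
  have hψ_ge (f : MvPowerSeries σ R) := le_weightedOrder_subst_of_forall_ne_zero w' hsub
    (fun s hs => one_ne_zero (α := R) (by simpa using congrArg (coeff (coverExponent a b c i s)) hs)) f
  have hfun : (ENat.toNat ∘ weightedOrder w' ∘
      fun s => (monomial (coverExponent a b c i s) (1 : R))) = w := by
    ext s
    simp [weightedOrder_monomial_of_ne_zero, hww]
  rw [hfun] at hψ_ge
  -- The cyclic cover kills `X a * X b - X c ^ i`.
  have hψp : p.subst (fun s => (monomial (coverExponent a b c i s) (1 : R))) =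
      h.subst (fun s => (monomial (coverExponent a b c i s) (1 : R))) := by
    rw [hp, subst_add hsub, subst_sub hsub, subst_mul hsub, subst_pow hsub, subst_X hsub,
      subst_X hsub, subst_X hsub]
    simp [coverExponent, hab.symm, hac.symm, hbc.symm, monomial_mul_monomial, monomial_pow]
  -- A product of two nonzero remainders is not divisible by `p`.
  have key {r s : MvPowerSeries σ R} (hr : ∀ ν, coeff ν r ≠ 0 → ν a = 0 ∨ ν b = 0)
      (hs : ∀ ν, coeff ν s ≠ 0 → ν a = 0 ∨ ν b = 0) (hrs : p ∣ r * s) : r * s = 0 := by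
    obtain ⟨z, hz⟩ := hrs
    by_contra hne
    have hz0 : z.weightedOrder w ≠ ⊤ := by
      rw [Ne, weightedOrder_eq_top_iff]
      rintro rfl
      exact hne (by rw [hz, mul_zero])
    have hp2 : p.weightedOrder w ≤ (2 * i : ℕ) := by
      refine (weightedOrder_le w (d := τ) (by rw [hcoeff]; exact one_ne_zero)).trans ?_
      simp [hτ, hw, Finsupp.weight_single, two_mul]
    have hh2 : ((2 * i + 2 : ℕ) : ℕ∞) ≤ h.weightedOrder w := by
      refine le_trans ?_ (nsmul_order_le_weightedOrder w 2 (fun s => by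
        simp only [hw]; split_ifs <;> omega) h)
      refine le_trans ?_ (nsmul_le_nsmul_right hh 2)
      rw [nsmul_eq_mul]
      exact_mod_cast (by omega)
    have h1 : ((2 * i + 2 : ℕ) : ℕ∞) + z.weightedOrder w ≤ (2 * i : ℕ) + z.weightedOrder w := by
      calc ((2 * i + 2 : ℕ) : ℕ∞) + z.weightedOrder w
          ≤ _ := add_le_add (hh2.trans (hψ_ge h)) (hψ_ge z)
        _ = _ := by rw [← hψp, ← weightedOrder_mul, ← subst_mul hsub, ← hz, subst_mul hsub,
              weightedOrder_mul]
        _ ≤ _ := add_le_add (hψ_le hr) (hψ_le hs)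
        _ = p.weightedOrder w + z.weightedOrder w := by
          rw [← weightedOrder_mul, hz, weightedOrder_mul]
        _ ≤ _ := by gcongr
    rw [ENat.add_le_add_iff_right hz0] at h1
    norm_cast at h1
    omega
  intro f g hfg
  obtain ⟨q, r, rfl, hr⟩ := hdiv f
  obtain ⟨q', s, rfl, hs⟩ := hdiv g
  have hrs : p ∣ r * s := by
    have : r * s = (p * q + r) * (p * q' + s) - p * (q * (p * q' + s) + r * q') := by ring
    rw [this]
    exact dvd_sub hfg (dvd_mul_right _ _)
  rcases mul_eq_zero.1 (key hr hs hrs) with rfl | rfl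
  · left; simp
  · right; simp

/-! ### Orders and powers of the maximal ideal -/

theorem le_order_of_mem_maximalIdeal_pow {σ k : Type*} [Field k] {n : ℕ} {f : MvPowerSeries σ k}
    (hf : f ∈ IsLocalRing.maximalIdeal (MvPowerSeries σ k) ^ n) : (n : ℕ∞) ≤ f.order := by
  induction n generalizing f with
  | zero => simp
  | succ n ih =>
    rw [pow_succ] at hf
    induction hf using Submodule.mul_induction_on' with
    | mem_mul_mem g hg x hx =>
      have h1 : 1 ≤ x.order := by
        rw [one_le_order_iff_constCoeff_eq_zero]
        by_contra h
        exact hx (isUnit_iff_constantCoeff.2 (isUnit_iff_ne_zero.2 h))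
      rw [Nat.cast_add, Nat.cast_one]
      exact (add_le_add (ih hg) h1).trans le_order_mul
    | add g _ x _ hg hx => exact (le_min hg hx).trans min_order_le_add

end MvPowerSeries

/-! ### The Artin functions of the two polynomials -/

section Artin

open MvPowerSeries

theorem le_artinFunction {A σ : Type*} [CommRing A] {I : Ideal A} {F : Set (MvPolynomial σ A)}
    {i n : ℕ} (h : ∀ b, IsArtinBound I F i b → n ≤ b) : (n : ℕ∞) ≤ artinFunction I F i :=
  le_iInf₂ fun b hb => by exact_mod_cast h b hb

theorem isArtinBound_crossPolynomial_iff {A : Type*} [CommRing A] {I : Ideal A} {i b : ℕ} :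
    IsArtinBound I {crossPolynomial A} i b ↔ ∀ x : Fin 4 → A,
      x 0 * x 1 - x 2 * x 3 ∈ I ^ (b + 1) →
        ∃ y : Fin 4 → A, y 0 * y 1 - y 2 * y 3 = 0 ∧ ∀ j, x j - y j ∈ I ^ (i + 1) := by
  simp [IsArtinBound, crossPolynomial]

theorem isArtinBound_productPolynomial_iff {A : Type*} [CommRing A] {I : Ideal A} {c : A}
    {i b : ℕ} :
    IsArtinBound I {productPolynomial c} i b ↔ ∀ x : Fin 2 → A,
      x 0 * x 1 - c ∈ I ^ (b + 1) →
        ∃ y : Fin 2 → A, y 0 * y 1 - c = 0 ∧ ∀ j, x j - y j ∈ I ^ (i + 1) := by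
  simp [IsArtinBound, productPolynomial]

theorem mem_maximalIdeal_of_map_eq_X {σ k A : Type*} [Field k] [CommRing A]
    [IsLocalRing A] (ι : A →+* MvPowerSeries σ k) {t : A} {a : σ} (ht : ι t = X a) :
    t ∈ IsLocalRing.maximalIdeal A := by
  intro h
  have := h.map ι
  rw [ht, isUnit_iff_constantCoeff] at this
  simp at this

variable {σ k A : Type*} [Field k] [CommRing A] [IsLocalRing A]
  (ι : A →+* MvPowerSeries σ k) [IsLocalHom ι]

theorem le_order_map_of_mem_maximalIdeal_pow {n : ℕ} {x : A}
    (hx : x ∈ IsLocalRing.maximalIdeal A ^ n) : (n : ℕ∞) ≤ (ι x).order := by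
  refine le_order_of_mem_maximalIdeal_pow ?_
  have h := Ideal.mem_map_of_mem ι hx
  rw [Ideal.map_pow] at h
  exact Ideal.pow_right_mono (IsLocalRing.map_maximalIdeal_le ι) n h

variable [Finite σ] {a b c : σ} {u v t : A}

/-- A factorization of `u * v - t ^ i` modulo `𝔪 ^ (i + 1)` is trivial: for `2 ≤ i` by primality of
the product, for `i ≤ 1` because `u * v - t ^ i` has order less than `2`. -/
theorem isUnit_or_isUnit_of_mul_sub_mem (hab : a ≠ b) (hac : a ≠ c) (hbc : b ≠ c)
    (hu : ι u = X a) (hv : ι v = X b) (ht : ι t = X c) {i : ℕ} {x y : A}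
    (hxy : x * y - (u * v - t ^ i) ∈ IsLocalRing.maximalIdeal A ^ (i + 1)) :
    IsUnit x ∨ IsUnit y := by
  classical
  have hord := le_order_map_of_mem_maximalIdeal_pow ι hxy
  suffices IsUnit (ι x) ∨ IsUnit (ι y) from
    this.imp (isUnit_of_map_unit ι x) (isUnit_of_map_unit ι y)
  by_contra! hnu
  have h1 (z : A) (hz : ¬IsUnit (ι z)) : 1 ≤ (ι z).order := by
    rw [one_le_order_iff_constCoeff_eq_zero]
    by_contra h
    exact hz (isUnit_iff_constantCoeff.2 (isUnit_iff_ne_zero.2 h))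
  have hxy2 : ((2 : ℕ) : ℕ∞) ≤ (ι x * ι y).order := by
    refine le_trans ?_ ((add_le_add (h1 x hnu.1) (h1 y hnu.2)).trans le_order_mul)
    norm_num
  rw [map_sub, map_mul, map_sub, map_mul, map_pow, hu, hv, ht] at hord
  have huv : ((2 : ℕ) : ℕ∞) ≤ (X a * X b : MvPowerSeries σ k).order := by
    rw [X, X, monomial_mul_monomial, one_mul, order_monomial_of_ne_zero one_ne_zero]
    simp [one_add_one_eq_two]
  rcases Nat.lt_or_ge i 2 with hi | hi
  · -- Only the term `X c ^ i` has a nonzero coefficient in degree `i`.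
    have hlt {f : MvPowerSeries σ k} {n : ℕ} (h : (n : ℕ∞) ≤ f.order) (hn : i < n) :
        coeff (Finsupp.single c i) f = 0 :=
      coeff_of_lt_order (lt_of_lt_of_le (by rw [Finsupp.degree_single]; exact_mod_cast hn) h)
    have h0 := hlt hord i.lt_succ_self
    rw [map_sub, map_sub, hlt hxy2 hi, hlt huv hi, X_pow_eq, coeff_monomial_same] at h0
    simp at h0
  · have hp := prime_X_mul_X_sub_X_pow_add (R := k) hab hac hbc hi hord
    rw [add_sub_cancel] at hp
    exact (hp.irreducible.isUnit_or_isUnit rfl).elim hnu.1 hnu.2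

/-- The bound `max i l` is admissible because one of the factors is a unit; it is optimal because of
the approximate solutions `(u, v)` and `(1, u * v - t ^ i + t ^ l)`. -/
theorem artinFunction_productPolynomial (hab : a ≠ b) (hac : a ≠ c) (hbc : b ≠ c)
    (hu : ι u = X a) (hv : ι v = X b) (ht : ι t = X c) (i l : ℕ) :
    artinFunction (IsLocalRing.maximalIdeal A) {productPolynomial (u * v - t ^ i)} l =
      (max i l : ℕ) := by
  classical
  refine le_antisymm (iInf₂_le _ ?_) (le_artinFunction fun n hn => ?_)
  · rw [isArtinBound_productPolynomial_iff]
    intro x hx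
    have hl := Ideal.pow_le_pow_right (I := IsLocalRing.maximalIdeal A)
      (Nat.succ_le_succ (le_max_right i l)) hx
    have hi := Ideal.pow_le_pow_right (I := IsLocalRing.maximalIdeal A)
      (Nat.succ_le_succ (le_max_left i l)) hx
    -- Keep the unit factor and solve for the other one.
    rcases isUnit_or_isUnit_of_mul_sub_mem ι hab hac hbc hu hv ht hi with h | h
    · obtain ⟨e, he⟩ := h.exists_left_inv
      refine ⟨![x 0, e * (u * v - t ^ i)], ?_, fun j => ?_⟩
      · simp only [Matrix.cons_val_zero, Matrix.cons_val_one]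
        linear_combination (u * v - t ^ i) * he
      · fin_cases j
        · simp
        · have : x 1 - e * (u * v - t ^ i) = e * (x 0 * x 1 - (u * v - t ^ i)) := by
            linear_combination (-x 1) * he
          simpa [this] using Ideal.mul_mem_left _ e hl
    · obtain ⟨e, he⟩ := h.exists_left_inv
      refine ⟨![e * (u * v - t ^ i), x 1], ?_, fun j => ?_⟩
      · simp only [Matrix.cons_val_zero, Matrix.cons_val_one]
        linear_combination (u * v - t ^ i) * he
      · fin_cases j
        · have : x 0 - e * (u * v - t ^ i) = e * (x 0 * x 1 - (u * v - t ^ i)) := by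
            linear_combination (-x 0) * he
          simpa [this] using Ideal.mul_mem_left _ e hl
        · simp
  · rw [isArtinBound_productPolynomial_iff] at hn
    by_contra! hlt
    have htm : ∀ m, n < m → t ^ m ∈ IsLocalRing.maximalIdeal A ^ (n + 1) := fun m hm =>
      Ideal.pow_le_pow_right hm (Ideal.pow_mem_pow (mem_maximalIdeal_of_map_eq_X ι ht) m)
    rcases lt_max_iff.1 hlt with hni | hnl
    · obtain ⟨y, hy, hxy⟩ := hn ![u, v] (by simpa using htm i hni)
      have hy' : y 0 * y 1 - (u * v - t ^ i) ∈ IsLocalRing.maximalIdeal A ^ (i + 1) := by simp [hy]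
      have hmem (j : Fin 2) (z : A) (hz : z ∈ IsLocalRing.maximalIdeal A)
          (hzy : z - y j ∈ IsLocalRing.maximalIdeal A ^ (l + 1)) : ¬IsUnit (y j) := by
        have := Ideal.sub_mem _ hz (Ideal.pow_le_self l.succ_ne_zero hzy)
        rwa [sub_sub_cancel] at this
      rcases isUnit_or_isUnit_of_mul_sub_mem ι hab hac hbc hu hv ht hy' with h | h
      · exact hmem 0 u (mem_maximalIdeal_of_map_eq_X ι hu) (hxy 0) h
      · exact hmem 1 v (mem_maximalIdeal_of_map_eq_X ι hv) (hxy 1) h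
    · obtain ⟨y, hy, hxy⟩ := hn ![1, u * v - t ^ i + t ^ l] (by simpa using htm l hnl)
      have h0 : 1 - y 0 ∈ IsLocalRing.maximalIdeal A ^ (l + 1) := hxy 0
      have h1 : u * v - t ^ i + t ^ l - y 1 ∈ IsLocalRing.maximalIdeal A ^ (l + 1) := hxy 1
      have : t ^ l = (u * v - t ^ i + t ^ l - y 1) + y 1 * (1 - y 0) := by
        linear_combination hy
      have hmem : t ^ l ∈ IsLocalRing.maximalIdeal A ^ (l + 1) := by
        rw [this]
        exact Ideal.add_mem _ h1 (Ideal.mul_mem_left _ _ h0)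
      have hord := le_order_map_of_mem_maximalIdeal_pow ι hmem
      rw [map_pow, ht, X_pow_eq, order_monomial_of_ne_zero one_ne_zero, Finsupp.degree_single]
        at hord
      norm_cast at hord
      omega

/-- The vector `(u ^ i, v ^ i, u * v - t ^ i, s)`, where `s` is the quotient of
`(u * v) ^ i - t ^ (i ^ 2)` by `u * v - t ^ i`, solves the equation up to `t ^ (i ^ 2)`. The third
coordinate of a solution close to it would be a prime dividing neither of the first two. -/
theorem le_artinFunction_crossPolynomial (hab : a ≠ b) (hac : a ≠ c) (hbc : b ≠ c)
    (hu : ι u = X a) (hv : ι v = X b) (ht : ι t = X c) (i : ℕ) :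
    ((i ^ 2 - 1 : ℕ) : ℕ∞) ≤
      artinFunction (IsLocalRing.maximalIdeal A) {crossPolynomial A} i := by
  classical
  refine le_artinFunction fun n hn => ?_
  rw [isArtinBound_crossPolynomial_iff] at hn
  by_contra! hlt
  -- For `i ≤ 1` the bound `i ^ 2 - 1` is `0`.
  have hi : 2 ≤ i := by
    by_contra! h
    interval_cases i <;> simp at hlt
  obtain ⟨s, hs⟩ := sub_dvd_pow_sub_pow (u * v) (t ^ i) i
  obtain ⟨y, hy, hxy⟩ := hn ![u ^ i, v ^ i, u * v - t ^ i, s] (by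
    have : u ^ i * v ^ i - (u * v - t ^ i) * s = t ^ (i ^ 2) := by
      rw [← hs, ← mul_pow, ← pow_mul, pow_two]; ring
    simp only [Matrix.cons_val, this]
    exact Ideal.pow_le_pow_right (by omega)
      (Ideal.pow_mem_pow (mem_maximalIdeal_of_map_eq_X ι ht) _))
  have hord (j : Fin 4) := le_order_map_of_mem_maximalIdeal_pow ι (hxy j)
  have h0 := hord 0
  have h1 := hord 1
  have h2 := hord 2
  simp only [Matrix.cons_val, map_sub, map_mul, map_pow, hu, hv, ht] at h0 h1 h2
  rw [← order_neg, neg_sub] at h2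
  have hp := prime_X_mul_X_sub_X_pow_add (R := k) hab hac hbc hi h2
  rw [add_sub_cancel] at hp
  have hdvd : ι (y 2) ∣ ι (y 0) * ι (y 1) :=
    ⟨ι (y 3), by rw [← map_mul, ← map_mul, sub_eq_zero.1 hy]⟩
  -- A multiple of `ι (y 2)` has no monomial `X d ^ i` with `d = a` or `d = b`.
  have hcoeff (d : σ) (hd : d ≠ c) (f : MvPowerSeries σ k)
      (hf : ((i + 1 : ℕ) : ℕ∞) ≤ (X d ^ i - f).order) : ¬ι (y 2) ∣ f := by
    have hz (m : ℕ) (hm : m ≤ i) : coeff (Finsupp.single d m) (ι (y 2)) = 0 := by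
      have hlt : ((Finsupp.single d m).degree : ℕ∞) < (ι (y 2) - (X a * X b - X c ^ i)).order :=
        lt_of_lt_of_le (by rw [Finsupp.degree_single]; exact_mod_cast (by omega)) h2
      have h := coeff_of_lt_order hlt
      rw [map_sub, sub_eq_zero] at h
      rw [h, map_sub, X_pow_eq, X, X, monomial_mul_monomial, coeff_monomial, coeff_monomial,
        if_neg, if_neg, sub_zero]
      · intro h
        have := DFunLike.congr_fun h c
        simp [hd] at this
        omega
      · intro h
        have ha := DFunLike.congr_fun h a
        have hb := DFunLike.congr_fun h b
        simp [Finsupp.single_apply, hab, hab.symm] at ha hb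
        grind
    rintro ⟨g, rfl⟩
    have h := coeff_of_lt_order (d := Finsupp.single d i) (lt_of_lt_of_le
      (by rw [Finsupp.degree_single]; exact_mod_cast i.lt_succ_self) hf)
    rw [map_sub, X_pow_eq, coeff_monomial_same, coeff_mul, Finset.sum_eq_zero, sub_zero] at h
    · exact one_ne_zero h
    · rintro ⟨μ, ν⟩ hμν
      rw [Finset.HasAntidiagonal.mem_antidiagonal] at hμν
      have hμ : μ = Finsupp.single d (μ d) := by
        ext j
        have := DFunLike.congr_fun hμν j
        rcases eq_or_ne j d with rfl | hj
        · simp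
        · simp [hj.symm] at this ⊢
          omega
      have hd := DFunLike.congr_fun hμν d
      simp only [Finsupp.add_apply, Finsupp.single_eq_same] at hd
      rw [hμ, hz _ (by omega), zero_mul]
  rcases hp.dvd_or_dvd hdvd with h | h
  · exact hcoeff a hac _ h0 h
  · exact hcoeff b hbc _ h1 h

/-! ### Affine bounds and convergent power series -/

theorem not_affine_of_sq_sub_one_le {β : ℕ → ℕ∞} (hβ : ∀ i : ℕ, ((i ^ 2 - 1 : ℕ) : ℕ∞) ≤ β i) :
    ¬∃ a b : ℝ, ∀ i : ℕ, ∃ n : ℕ, β i ≤ n ∧ (n : ℝ) ≤ a * i + b := by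
  rintro ⟨a, b, h⟩
  obtain ⟨i, hi⟩ := exists_nat_gt (|a| + |b| + 1)
  obtain ⟨n, hn, hnb⟩ := h i
  have h1 : i ^ 2 - 1 ≤ n := by exact_mod_cast (hβ i).trans hn
  have h2 : (i : ℝ) ^ 2 ≤ n + 1 := by exact_mod_cast (by omega : i ^ 2 ≤ n + 1)
  have ha := le_abs_self a
  have hb := le_abs_self b
  have ha0 := abs_nonneg a
  have hb0 := abs_nonneg b
  nlinarith [mul_le_mul_of_nonneg_right ha (by linarith : (0 : ℝ) ≤ i)]

end Artin

instance convergentSeries.isLocalHom_subtype (N : ℕ) (k : Type*) [NormedField k] :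
    IsLocalHom (convergentSeries N k).subtype := by
  refine ⟨fun f hf => ?_⟩
  obtain ⟨g, hg⟩ := hf.exists_right_inv
  exact IsUnit.of_mul_eq_one ⟨g, f.2.of_mul_eq_one hg⟩ (Subtype.ext hg)

theorem mainTheorem2 (N : ℕ) (hN : 3 ≤ N) :
    -- formal power series over an arbitrary field
    (∀ (k : Type*) [Field k],
      (∀ i : ℕ, ((i ^ 2 - 1 : ℕ) : ℕ∞) ≤
        artinFunction (IsLocalRing.maximalIdeal (MvPowerSeries (Fin N) k))
          {crossPolynomial (MvPowerSeries (Fin N) k)} i) ∧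
      (¬ ∃ a b : ℝ, ∀ i : ℕ, ∃ n : ℕ,
        artinFunction (IsLocalRing.maximalIdeal (MvPowerSeries (Fin N) k))
          {crossPolynomial (MvPowerSeries (Fin N) k)} i ≤ n ∧
          (n : ℝ) ≤ a * i + b) ∧
      (∀ i l : ℕ,
        artinFunction (IsLocalRing.maximalIdeal (MvPowerSeries (Fin N) k))
          {productPolynomial
            (MvPowerSeries.X ⟨0, by omega⟩ * MvPowerSeries.X ⟨1, by omega⟩ -
              MvPowerSeries.X ⟨2, by omega⟩ ^ i : MvPowerSeries (Fin N) k)} l = (max i l : ℕ))) ∧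
    -- convergent power series over an arbitrary normed field
    (∀ (k : Type*) [NormedField k],
      (∀ i : ℕ, ((i ^ 2 - 1 : ℕ) : ℕ∞) ≤
        artinFunction (IsLocalRing.maximalIdeal (convergentSeries N k))
          {crossPolynomial (convergentSeries N k)} i) ∧
      (¬ ∃ a b : ℝ, ∀ i : ℕ, ∃ n : ℕ,
        artinFunction (IsLocalRing.maximalIdeal (convergentSeries N k))
          {crossPolynomial (convergentSeries N k)} i ≤ n ∧
          (n : ℝ) ≤ a * i + b) ∧
      (∀ i l : ℕ,
        artinFunction (IsLocalRing.maximalIdeal (convergentSeries N k))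
          {productPolynomial
            (convergentSeries.T k ⟨0, by omega⟩ * convergentSeries.T k ⟨1, by omega⟩ -
              convergentSeries.T k ⟨2, by omega⟩ ^ i : convergentSeries N k)} l = (max i l : ℕ))) := by
  have h01 : (⟨0, by omega⟩ : Fin N) ≠ ⟨1, by omega⟩ := by simp
  have h02 : (⟨0, by omega⟩ : Fin N) ≠ ⟨2, by omega⟩ := by simp
  have h12 : (⟨1, by omega⟩ : Fin N) ≠ ⟨2, by omega⟩ := by simp
  refine ⟨fun k _ => ?_, fun k _ => ?_⟩
  · have hcross := le_artinFunction_crossPolynomial (RingHom.id (MvPowerSeries (Fin N) k))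
      h01 h02 h12 rfl rfl rfl
    exact ⟨hcross, not_affine_of_sq_sub_one_le hcross,
      artinFunction_productPolynomial (RingHom.id _) h01 h02 h12 rfl rfl rfl⟩
  · have hcross := le_artinFunction_crossPolynomial (convergentSeries N k).subtype h01 h02 h12
      (u := convergentSeries.T k _) (v := convergentSeries.T k _) (t := convergentSeries.T k _)
      rfl rfl rfl
    exact ⟨hcross, not_affine_of_sq_sub_one_le hcross,
      artinFunction_productPolynomial (convergentSeries N k).subtype h01 h02 h12 rfl rfl rfl⟩
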